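/- Let $M$ be a rotationally symmetric torus with horizontal symmetry, i.e. $\mathbb S^1\times[-t_0,t_0]$ ($t_0>0$, $\mathbb S^1=\mathbb R/2\pi\mathbb Z$) with the metric $ds^2=dt^2+f(t)^2\,d\theta^2$ and the boundary circles $\mathbb S^1\times\{\pm t_0\}$ identified, where $f>0$ is $C^1$, $f''$ exists and is continuous except possibly at finitely many points, $f(-t)=f(t)$ for all $t$, and $f'(\pm t_0)=0$. Assume that the Gauss curvature $K=-f''/f$ is a (weakly) decreasing function of the distance $|t|$ from the parallel $\mathbb S^1\times\{0\}$ (at the points where $f''$ is defined and continuous). Assume that there is $\tilde t\in[-t_0,t_0]$, $\tilde t\neq 0$, with $$\big[(f')^2-f f''\big](\tilde t)=1,$$ such that in a neighborhood of $\mathbb S^1\times\{\tilde t\}$ the curvature $K$ is smooth and is a strictly decreasing function of $|t|$. Then there are closed embedded unduloid type curves in $M$, of period $2\pi$, arbitrarily close to $\mathbb S^1\times\{\tilde t\}$: for every $\varepsilon>0$ there is a closed embedded unduloid type curve $\gamma(s)=(\theta(s),t(s))$ in $M$ of period $2\pi$ with $|t(s)-\tilde t|<\varepsilon$ for all $s$.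 Here, for a curve $\gamma(s)=(\theta(s),t(s))$ parametrized by arc length, $\sigma$ denotes the oriented angle from $\partial_t$ to $\gamma'$, so that $t'=\cos\sigma$ and $\theta'=\sin\sigma/f(t)$, and its geodesic curvature is taken with respect to the normal $N=\frac{\cos\sigma}{f(t)}\partial_\theta-\sin\sigma\,\partial_t$. It is an \emph{unduloid type curve} if its geodesic curvature is constant, the coordinate $t$ has a strict local maximum at some $s_0$ with $\sin\sigma(s_0)=1$, and $\sin\sigma(s_1)=1$ at the next critical point $s_1>s_0$ of $t$. Its \emph{period} is the $\theta$-distance (on the lift of the curve to $\theta\in\mathbb R$) between two consecutive strict local maximum points of $t$. -/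

import Mathlib

open scoped Topology ContDiff

/-- A rotationally symmetric torus: `𝕊¹ × [-t0, t0]` with the metric `dt² + f(t)² dθ²` and its two
boundary circles identified.  The warping function `f > 0` is `C¹` and piecewise `C²`, with
`f (-t0) = f t0` and `f' (-t0) = f' t0 = 0`.  We use the `2 t0`-periodic extension of `f` to `ℝ`;
under these boundary conditions it is again `C¹`. -/
structure RotTorus where
  t0 : ℝ
  t0_pos : 0 < t0
  f : ℝ → ℝ
  f_pos : ∀ t, 0 < f t
  f_periodic : Function.Periodic f (2 * t0)
  f_contDiff : ContDiff ℝ 1 f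
  deriv_f_t0 : deriv f t0 = 0
  f_piecewise : ∃ S : Set ℝ, S.Finite ∧ ∀ t ∈ Set.Icc (-t0) t0, t ∉ S → ContDiffAt ℝ 2 f t

namespace RotTorus

/-- The torus as a topological space; the first coordinate is the angle `θ` modulo `2π`, the
second one the height `t` modulo `2 t0`. -/
abbrev Surface (M : RotTorus) : Type := AddCircle (2 * Real.pi) × AddCircle (2 * M.t0)

/-- Symmetry with respect to the parallel `𝕊¹ × {0}`. -/
def HorizontallySymmetric (M : RotTorus) : Prop := ∀ t, M.f (-t) = M.f t

/-- The Gauss curvature `K(t) = -f''(t) / f(t)`; meaningful where `f` is twice differentiable. -/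
noncomputable def K (M : RotTorus) (t : ℝ) : ℝ := -deriv (deriv M.f) t / M.f t

/-- The Gauss curvature is a (weakly) decreasing function of the distance `|t|` from the parallel
`𝕊¹ × {0}`, at the points where it is defined and continuous. -/
def CurvatureDecreasing (M : RotTorus) : Prop :=
  ∀ s ∈ Set.Icc (-M.t0) M.t0, ∀ t ∈ Set.Icc (-M.t0) M.t0,
    ContDiffAt ℝ 2 M.f s → ContDiffAt ℝ 2 M.f t → |s| ≤ |t| → M.K t ≤ M.K s

/-- The Gauss curvature is defined and smooth on the set `𝕊¹ × U`. -/
def CurvatureSmoothOn (M : RotTorus) (U : Set ℝ) : Prop :=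
  (∀ t ∈ U, ContDiffAt ℝ 2 M.f t) ∧ ContDiffOn ℝ ∞ M.K U

/-- On `𝕊¹ × U`, the Gauss curvature is a strictly decreasing function of the distance `|t|` from
the parallel `𝕊¹ × {0}`. -/
def CurvatureStrictlyDecreasingOn (M : RotTorus) (U : Set ℝ) : Prop :=
  ∀ s ∈ U ∩ Set.Icc (-M.t0) M.t0, ∀ t ∈ U ∩ Set.Icc (-M.t0) M.t0, |s| < |t| → M.K t < M.K s

/-- The Riemannian metric `f(t)² dθ² + dt²` at height `t`; a tangent vector `v` is
`v.1 ∂θ + v.2 ∂t`. -/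
noncomputable def metric (M : RotTorus) (t : ℝ) (v w : ℝ × ℝ) : ℝ :=
  M.f t ^ 2 * v.1 * w.1 + v.2 * w.2

/-- A `C²` curve in `M` parametrized by arc length, given by its lift `s ↦ (θ(s), t(s))` to the
universal cover `ℝ × ℝ`. -/
structure Curve (M : RotTorus) where
  θ : ℝ → ℝ
  t : ℝ → ℝ
  contDiff_θ : ContDiff ℝ 2 θ
  contDiff_t : ContDiff ℝ 2 t
  unit_speed : ∀ s, M.metric (t s) (deriv θ s, deriv t s) (deriv θ s, deriv t s) = 1

namespace Curve

variable {M : RotTorus}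

/-- The point of the torus at parameter `s`. -/
noncomputable def point (γ : M.Curve) (s : ℝ) : M.Surface :=
  ((γ.θ s : AddCircle (2 * Real.pi)), (γ.t s : AddCircle (2 * M.t0)))

/-- The covariant derivative of the velocity along the curve for the Levi-Civita connection; the
non-zero Christoffel symbols of `f² dθ² + dt²` are `Γ^θ_{θt} = Γ^θ_{tθ} = f'/f` and
`Γ^t_{θθ} = -f f'`. -/
noncomputable def covariantAcceleration (γ : M.Curve) (s : ℝ) : ℝ × ℝ :=
  (deriv (deriv γ.θ) s
      + 2 * (deriv M.f (γ.t s) / M.f (γ.t s)) * deriv γ.θ s * deriv γ.t s,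
   deriv (deriv γ.t) s - M.f (γ.t s) * deriv M.f (γ.t s) * deriv γ.θ s ^ 2)

/-- `cos σ`, where `σ` is the oriented angle from `∂t` to the velocity of the curve. -/
noncomputable def cosAngle (γ : M.Curve) (s : ℝ) : ℝ := deriv γ.t s

/-- `sin σ`, where `σ` is the oriented angle from `∂t` to the velocity of the curve. -/
noncomputable def sinAngle (γ : M.Curve) (s : ℝ) : ℝ := M.f (γ.t s) * deriv γ.θ s

/-- The unit normal `N = (cos σ / f) ∂θ - sin σ ∂t`. -/
noncomputable def normal (γ : M.Curve) (s : ℝ) : ℝ × ℝ :=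
  (γ.cosAngle s / M.f (γ.t s), -γ.sinAngle s)

/-- The geodesic curvature with respect to the normal `N`. -/
noncomputable def geodesicCurvature (γ : M.Curve) (s : ℝ) : ℝ :=
  M.metric (γ.t s) (γ.covariantAcceleration s) (γ.normal s)

/-- `s` is a strict (local) maximum point of the `t`-coordinate. -/
def IsStrictMax (γ : M.Curve) (s : ℝ) : Prop := ∀ᶠ r in 𝓝[≠] s, γ.t r < γ.t s

/-- Unduloid type curve: the geodesic curvature is constant, the `t`-coordinate has a strict
maximum at some `s₀`, with `sin σ = 1` there, and at the next critical point `s₁ > s₀` of the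
`t`-coordinate again `sin σ = 1` (and not `-1`). -/
def IsUnduloidType (γ : M.Curve) : Prop :=
  (∃ h : ℝ, ∀ s, γ.geodesicCurvature s = h) ∧
  ∃ s₀ s₁ : ℝ, s₀ < s₁ ∧ γ.IsStrictMax s₀ ∧ γ.sinAngle s₀ = 1 ∧
    deriv γ.t s₁ = 0 ∧ (∀ s ∈ Set.Ioo s₀ s₁, deriv γ.t s ≠ 0) ∧ γ.sinAngle s₁ = 1

/-- `s₀ < s₁` are consecutive maximum points of the `t`-coordinate. -/
def AreConsecutiveMax (γ : M.Curve) (s₀ s₁ : ℝ) : Prop :=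
  s₀ < s₁ ∧ γ.IsStrictMax s₀ ∧ γ.IsStrictMax s₁ ∧ ∀ s ∈ Set.Ioo s₀ s₁, ¬ γ.IsStrictMax s

/-- The `θ`-distance between any two consecutive maximum points of the `t`-coordinate is `P`
(and there are such points). -/
def HasPeriod (γ : M.Curve) (P : ℝ) : Prop :=
  (∃ s₀ s₁, γ.AreConsecutiveMax s₀ s₁) ∧
  ∀ s₀ s₁, γ.AreConsecutiveMax s₀ s₁ → |γ.θ s₁ - γ.θ s₀| = P

/-- The curve is closed and embedded in the torus: it is periodic of some period `ℓ > 0` and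
injective modulo `ℓ`. -/
def IsClosedEmbedded (γ : M.Curve) : Prop :=
  ∃ ℓ : ℝ, 0 < ℓ ∧ Function.Periodic γ.point ℓ ∧
    ∀ r s, γ.point r = γ.point s → ∃ n : ℤ, s = r + n * ℓ

end Curve

end RotTorus

/-! Clairaut's relation for constant geodesic curvature `h` says that `u = f sin σ`, as a function
of the height, satisfies `u' = h f`; thus `u` is affine in the variable `∫ f`. Along the curve `t'²
= 1 - (u/f)²` and `θ' = u/f²`, so an unduloid oscillates between two heights `m ± a` where `u = f`:
it corresponds to a short secant of `f`. With `t = m + a cos φ` one has `f² - u² = (a sin φ)² E(φ)`,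
where `E` stays continuous and positive at the turning points, and the period is `∫ u / (f √E) dφ`
over `[0, 2π]`. If this equals `2π`, the curve closes up after one oscillation and, since `θ`
increases, is embedded (`exists_unduloid_of_secant`). As `a → 0`, `E` tends to `q = f'² - f f''` and
the period to `2π / √(q m)`. Since `q' = f² K'`, strict monotonicity of `K` makes `q` cross the
value `1` at `τ` (`exists_q_lt_one_lt_q`). For a small fixed `a` the periods at two centres on
either side of `τ` therefore lie on both sides of `2π`, and the intermediate value theorem in `m`
yields a suitable secant (`exists_secant_period_eq_two_pi`). -/

/-! ### Calculus and an autonomous differential equation. -/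

open MeasureTheory in
/-- A continuous function that has a continuous derivative `A` outside of a countable set has
derivative `A` everywhere. -/
theorem hasDerivAt_of_hasDerivAt_off_countable {T A : ℝ → ℝ} {Z : Set ℝ} (hZ : Z.Countable)
    (hT : Continuous T) (hA : Continuous A) (h : ∀ s ∉ Z, HasDerivAt T (A s) s) (s : ℝ) :
    HasDerivAt T (A s) s := by
  have key : ∀ x, T x = T 0 + ∫ r in (0 : ℝ)..x, A r := fun x => by
    rw [integral_eq_of_hasDerivAt_off_countable T A hZ hT.continuousOn
      (fun y hy => h y hy.2) (hA.intervalIntegrable _ _)]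
    ring
  have := (intervalIntegral.integral_hasDerivAt_right (hA.intervalIntegrable 0 s)
    (hA.stronglyMeasurableAtFilter _ _) hA.continuousAt).const_add (T 0)
  exact this.congr_of_eventuallyEq (Filter.Eventually.of_forall key)

/-- The derivative of a continuous nonvanishing function can be read off from its square. -/
theorem HasDerivAt.of_sq {T : ℝ → ℝ} {A s : ℝ} (hT : Continuous T) (h0 : T s ≠ 0)
    (h : HasDerivAt (fun r => T r ^ 2) (2 * T s * A) s) : HasDerivAt T A s := by
  rcases lt_or_gt_of_ne h0 with h1 | h1
  · have h2 := (h.sqrt (pow_ne_zero 2 h0)).neg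
    rw [Real.sqrt_sq_eq_abs, abs_of_neg h1] at h2
    have h3 : HasDerivAt T (-(2 * T s * A / (2 * -T s))) s := by
      refine h2.congr_of_eventuallyEq ?_
      filter_upwards [hT.continuousAt.eventually_lt continuousAt_const h1] with r hr
      simp [Real.sqrt_sq_eq_abs, abs_of_neg hr]
    convert h3 using 1
    field_simp
  · have h2 := h.sqrt (pow_ne_zero 2 h0)
    rw [Real.sqrt_sq_eq_abs, abs_of_pos h1] at h2
    have h3 : HasDerivAt T (2 * T s * A / (2 * T s)) s := by
      refine h2.congr_of_eventuallyEq ?_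
      filter_upwards [continuousAt_const.eventually_lt hT.continuousAt h1] with r hr
      simp [Real.sqrt_sq_eq_abs, abs_of_pos hr]
    convert h3 using 1
    field_simp

theorem contDiff_two_of_hasDerivAt {f f' f'' : ℝ → ℝ} (h : ∀ s, HasDerivAt f (f' s) s)
    (h' : ∀ s, HasDerivAt f' (f'' s) s) (hc : Continuous f'') : ContDiff ℝ 2 f := by
  have e1 : deriv f = f' := funext fun s => (h s).deriv
  have e2 : deriv f' = f'' := funext fun s => (h' s).deriv
  have : ContDiff ℝ 1 f' :=
    contDiff_one_iff_deriv.2 ⟨fun s => (h' s).differentiableAt, e2 ▸ hc⟩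
  exact contDiff_succ_iff_deriv (n := 1) |>.2
    ⟨fun s => (h s).differentiableAt, by simp, e1 ▸ this⟩

theorem hasDerivAt_integral_of_continuous {w : ℝ → ℝ} (hw : Continuous w) (x : ℝ) :
    HasDerivAt (fun y => ∫ r in (0 : ℝ)..y, w r) (w x) x :=
  intervalIntegral.integral_hasDerivAt_right (hw.intervalIntegrable 0 x)
    (hw.stronglyMeasurableAtFilter _ _) hw.continuousAt

/-- The inverse of the primitive of a positive periodic function `w`: a solution of the autonomous
equation `φ' = 1 / w(φ)`. -/
theorem exists_solution_of_periodic {w : ℝ → ℝ} {P : ℝ} (hP : 0 < P) (hw : Continuous w)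
    (hpos : ∀ x, 0 < w x) (hper : Function.Periodic w P) :
    ∃ (φ : ℝ → ℝ) (L : ℝ), 0 < L ∧ StrictMono φ ∧ Function.Surjective φ ∧
      (∀ s, HasDerivAt φ (w (φ s))⁻¹ s) ∧ ∀ s, φ (s + L) = φ s + P := by
  set S : ℝ → ℝ := fun y => ∫ r in (0 : ℝ)..y, w r with hS
  have hd : ∀ x, HasDerivAt S (w x) x := hasDerivAt_integral_of_continuous hw
  have hint : ∀ a b, IntervalIntegrable w MeasureTheory.volume a b := fun a b => hw.intervalIntegrable a b
  have hmono : StrictMono S := strictMono_of_deriv_pos fun x => by rw [(hd x).deriv]; exact hpos x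
  have hcont : Continuous S := continuous_iff_continuousAt.2 fun x => (hd x).continuousAt
  have hsurj : Function.Surjective S := hcont.surjective
    (hper.tendsto_atTop_intervalIntegral_of_pos' (hint 0 P) hpos hP)
    (hper.tendsto_atBot_intervalIntegral_of_pos' (hint 0 P) hpos hP)
  let e := hmono.orderIsoOfSurjective S hsurj
  have he : ∀ x, e x = S x := fun _ => rfl
  have hadd : ∀ x, S (x + P) = S x + S P := fun x => by
    have h1 := intervalIntegral.integral_add_adjacent_intervals (hint 0 x) (hint x (x + P))
    have h2 := hper.intervalIntegral_add_eq x 0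
    rw [zero_add] at h2
    simp only [hS]
    rw [← h1, h2]
  refine ⟨e.symm, S P, intervalIntegral.intervalIntegral_pos_of_pos (hint 0 P) hpos hP,
    e.symm.strictMono, e.symm.surjective, fun s => ?_, fun s => ?_⟩
  · refine HasDerivAt.of_local_left_inverse (f := S) e.symm.continuous.continuousAt (hd _)
      (hpos _).ne' (Filter.Eventually.of_forall fun y => ?_)
    exact e.apply_symm_apply y
  · rw [OrderIso.symm_apply_eq, he, hadd, ← he (e.symm s), e.apply_symm_apply]

/-! ### From a secant to a closed embedded unduloid. -/

open Real in
/-- A secant line `u` of `f` over `[m - a, m + a]` (with respect to the variable `∫ f`) whose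
period integral equals `2π` gives a closed embedded unduloid. -/
theorem RotTorus.exists_unduloid_of_secant (M : RotTorus) {m a h : ℝ} (ha : 0 < a)
    {u E : ℝ → ℝ} (hE : Continuous E) (hE0 : ∀ φ, 0 < E φ) (hEper : Function.Periodic E (2 * π))
    (hu : ∀ x ∈ Set.Icc (m - a) (m + a), HasDerivAt u (h * M.f x) x)
    (hid : ∀ φ, M.f (m + a * cos φ) ^ 2 - u (m + a * cos φ) ^ 2 = (a * sin φ) ^ 2 * E φ)
    (hu0 : ∀ φ, 0 < u (m + a * cos φ))
    (hint : ∫ φ in (0 : ℝ)..(2 * π), u (m + a * cos φ) / (M.f (m + a * cos φ) * √(E φ)) = 2 * π) :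
    ∃ γ : M.Curve, γ.IsUnduloidType ∧ γ.IsClosedEmbedded ∧ γ.HasPeriod (2 * π) ∧
      ∀ s, γ.t s ∈ Set.Icc (m - a) (m + a) := by
  have hpi := two_pi_pos
  have hX : ∀ φ, m + a * cos φ ∈ Set.Icc (m - a) (m + a) := fun φ => by
    constructor <;> nlinarith [neg_one_le_cos φ, cos_le_one φ]
  have hf : ∀ x, HasDerivAt M.f (deriv M.f x) x := fun x =>
    (M.f_contDiff.differentiable one_ne_zero x).hasDerivAt
  have hfc : Continuous M.f := M.f_contDiff.continuous
  have hf'c : Continuous (deriv M.f) := M.f_contDiff.continuous_deriv le_rfl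
  have hf0 := M.f_pos
  have hucos : Continuous fun φ => u (m + a * cos φ) := continuous_iff_continuousAt.2 fun φ =>
    ContinuousAt.comp (f := fun φ => m + a * cos φ) (hu _ (hX φ)).continuousAt
      (by fun_prop)
  have hsq : ∀ φ, 0 < √(E φ) := fun φ => sqrt_pos.2 (hE0 φ)
  -- the angle as a function of arc length
  obtain ⟨φ, L, hL, φmono, φsurj, φd, φadd⟩ := exists_solution_of_periodic
    (w := fun φ => M.f (m + a * cos φ) / √(E φ)) (P := 2 * π) hpi
    (by have := fun φ => (hsq φ).ne'; fun_prop (disch := assumption))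
    (fun x => div_pos (hf0 _) (hsq x)) (fun x => by simp only [cos_add_two_pi, hEper x])
  have φc : Continuous φ := continuous_iff_continuousAt.2 fun s => (φd s).continuousAt
  simp only [inv_div] at φd
  -- the coordinate `t`
  set t : ℝ → ℝ := fun s => m + a * cos (φ s) with ht
  have htI : ∀ s, t s ∈ Set.Icc (m - a) (m + a) := fun s => hX _
  have htc : Continuous t := by fun_prop
  have huc : Continuous fun s => u (t s) := hucos.comp φc
  -- Using `sin φ` in place of a root of `1 - (u/f)²` gives `t'` the correct sign on both sides of a
  -- turning point.
  set T : ℝ → ℝ := fun s => -(a * sin (φ s)) * (√(E (φ s)) / M.f (t s)) with hT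
  have htd : ∀ s, HasDerivAt t (T s) s := fun s => by
    have := (((hasDerivAt_cos (φ s)).comp s (φd s)).const_mul a).const_add m
    refine this.congr_deriv ?_
    simp only [hT, ht]; ring
  have hTc : Continuous T := by
    have := fun s => (hf0 (t s)).ne'
    fun_prop (disch := assumption)
  have hTsq : ∀ s, T s ^ 2 = 1 - (u (t s) / M.f (t s)) ^ 2 := fun s => by
    have h1 := hid (φ s)
    have h2 : √(E (φ s)) ^ 2 = E (φ s) := sq_sqrt (hE0 _).le
    have h3 := (hf0 (t s)).ne'
    simp only [hT]
    rw [mul_pow, div_pow, h2, neg_sq]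
    field_simp
    linarith
  set B' : ℝ → ℝ := fun s => h - u (t s) * deriv M.f (t s) / M.f (t s) ^ 2 with hB'
  have hB'c : Continuous B' := continuous_const.sub <|
    (huc.mul (hf'c.comp htc)).div ((hfc.comp htc).pow 2) fun s => pow_ne_zero 2 (hf0 (t s)).ne'
  have hBd : ∀ s, HasDerivAt (fun s => u (t s) / M.f (t s)) (B' s * T s) s := fun s => by
    have h3 := (hf0 (t s)).ne'
    have := ((hu _ (htI s)).div (hf (t s)) h3).comp s (htd s)
    refine this.congr_deriv ?_
    simp only [hB']
    field_simp
  set A : ℝ → ℝ := fun s => -(u (t s) / M.f (t s)) * B' s with hA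
  have hBc : Continuous fun s => u (t s) / M.f (t s) := huc.div (hfc.comp htc) fun s => (hf0 _).ne'
  have hAc : Continuous A := hBc.neg.mul hB'c
  have hT0 : ∀ s, T s = 0 ↔ sin (φ s) = 0 := fun s => by
    have h1 := (div_pos (hsq (φ s)) (hf0 (t s))).ne'
    simp [hT, ha.ne', (hsq (φ s)).ne', (hf0 (t s)).ne']
  -- `E` is only continuous, so the formula for `T` cannot be differentiated directly. Where `T ≠ 0`
  -- one differentiates `T² = 1 - (u/f)²`; the turning points are countable and `A` is continuous
  -- across them.
  have hTd : ∀ s, HasDerivAt T (A s) s := by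
    refine hasDerivAt_of_hasDerivAt_off_countable (Z := φ ⁻¹' Set.range fun k : ℤ => k * π)
      ((Set.countable_range _).preimage φmono.injective) hTc hAc fun s hs => ?_
    have h0 : T s ≠ 0 := fun h0 => hs <| by
      obtain ⟨k, hk⟩ := sin_eq_zero_iff.1 ((hT0 s).1 h0)
      exact ⟨k, hk⟩
    refine HasDerivAt.of_sq hTc h0 ?_
    simp only [hTsq]
    refine (((hBd s).pow 2).const_sub 1).congr_deriv ?_
    simp only [hA]; push_cast; ring
  -- the coordinate `θ`
  set W : ℝ → ℝ := fun φ => u (m + a * cos φ) / (M.f (m + a * cos φ) * √(E φ)) with hW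
  have hWc : Continuous W := hucos.div (by fun_prop) fun φ => (mul_pos (hf0 _) (hsq φ)).ne'
  have hW0 : ∀ x, 0 < W x := fun x => div_pos (hu0 x) (mul_pos (hf0 _) (hsq x))
  have hWper : Function.Periodic W (2 * π) := fun x => by
    simp only [hW, cos_add_two_pi, hEper x]
  set Θ : ℝ → ℝ := fun y => ∫ r in (0 : ℝ)..y, W r with hΘ
  have hΘd : ∀ x, HasDerivAt Θ (W x) x := hasDerivAt_integral_of_continuous hWc
  have hΘadd : ∀ x, Θ (x + 2 * π) = Θ x + 2 * π := fun x => by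
    have h1 := intervalIntegral.integral_add_adjacent_intervals (μ := MeasureTheory.volume)
      (hWc.intervalIntegrable 0 x) (hWc.intervalIntegrable x (x + 2 * π))
    have h2 := hWper.intervalIntegral_add_eq x 0
    rw [zero_add, hint] at h2
    simp only [hΘ]
    rw [← h1, h2]
  have hΘmono : StrictMono Θ := strictMono_of_deriv_pos fun x => by
    rw [(hΘd x).deriv]; exact hW0 x
  set θ : ℝ → ℝ := fun s => Θ (φ s) with hθ
  have hθmono : StrictMono θ := hΘmono.comp φmono
  set V : ℝ → ℝ := fun s => u (t s) / M.f (t s) / M.f (t s) with hV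
  have hθd : ∀ s, HasDerivAt θ (V s) s := fun s => by
    refine ((hΘd (φ s)).comp s (φd s)).congr_deriv ?_
    have h1 := (hsq (φ s)).ne'
    have h2 := (hf0 (m + a * cos (φ s))).ne'
    simp only [hW, hV, ht]
    field_simp
  set V' : ℝ → ℝ := fun s => (B' s * M.f (t s) - u (t s) / M.f (t s) * deriv M.f (t s)) * T s /
    M.f (t s) ^ 2 with hV'
  have hVd : ∀ s, HasDerivAt V (V' s) s := fun s => by
    refine ((hBd s).div ((hf (t s)).comp s (htd s)) (hf0 (t s)).ne').congr_deriv ?_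
    simp only [hV', Function.comp_apply]
    ring
  have hV'c : Continuous V' := (((hB'c.mul (hfc.comp htc)).sub
    (hBc.mul (hf'c.comp htc))).mul hTc).div ((hfc.comp htc).pow 2)
      fun s => pow_ne_zero 2 (hf0 (t s)).ne'
  have dt : deriv t = T := funext fun s => (htd s).deriv
  have dT : deriv T = A := funext fun s => (hTd s).deriv
  have dθ : deriv θ = V := funext fun s => (hθd s).deriv
  have dV : deriv V = V' := funext fun s => (hVd s).deriv
  let γ : M.Curve :=
    { θ := θ
      t := t
      contDiff_θ := contDiff_two_of_hasDerivAt hθd hVd hV'c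
      contDiff_t := contDiff_two_of_hasDerivAt htd hTd hAc
      unit_speed := fun s => by
        have h1 := hTsq s
        have h2 := (hf0 (t s)).ne'
        simp only [RotTorus.metric, dt, dθ, hV]
        rw [← pow_two (T s), mul_assoc, ← pow_two, h1]
        field_simp
        ring }
  have γt : γ.t = t := rfl
  have γθ : γ.θ = θ := rfl
  -- At a turning point `f² = u²`; positivity of `u` excludes `sin σ = -1`.
  have hsin1 : ∀ s, sin (φ s) = 0 → γ.sinAngle s = 1 := fun s hs => by
    have h1 := hid (φ s)
    rw [hs, mul_zero, zero_pow two_ne_zero, zero_mul, sub_eq_zero,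
      pow_left_inj₀ (hf0 _).le (hu0 _).le two_ne_zero] at h1
    have h2 := (hf0 (t s)).ne'
    have h3 : u (t s) = M.f (t s) := h1.symm
    simp only [RotTorus.Curve.sinAngle, γt, γθ, dθ, hV, h3]
    field_simp
  -- the maximum points of `t`
  have hmax : ∀ s, γ.IsStrictMax s ↔ ∃ k : ℤ, φ s = k * (2 * π) := by
    intro s
    constructor
    · intro hs
      have hloc : IsLocalMax t s := by
        have := eventually_nhdsWithin_iff.1 hs
        filter_upwards [this] with r hr
        rcases eq_or_ne r s with rfl | hne
        · exact le_rfl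
        · exact (hr hne).le
      have h0 : sin (φ s) = 0 := (hT0 s).1 (by rw [← dt]; exact hloc.deriv_eq_zero)
      have hc : cos (φ s) = 1 := by
        rcases sin_eq_zero_iff_cos_eq.1 h0 with hc | hc
        · exact hc
        · exfalso
          obtain ⟨r, hr⟩ := hs.exists
          have h1 : t s = m - a := by simp only [ht, hc]; ring
          have h2 := (htI r).1
          rw [γt] at hr
          linarith
      obtain ⟨k, hk⟩ := (cos_eq_one_iff _).1 hc
      exact ⟨k, hk.symm⟩
    · rintro ⟨k, hk⟩
      have h1 : t s = m + a := by simp [ht, hk]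
      have h2 : ∀ᶠ r in 𝓝 s, φ r ∈ Set.Ioo ((k : ℝ) * (2 * π) - 2 * π) (k * (2 * π) + 2 * π) :=
        φc.continuousAt (Ioo_mem_nhds (by rw [hk]; linarith) (by rw [hk]; linarith))
      filter_upwards [nhdsWithin_le_nhds h2, self_mem_nhdsWithin] with r hr hrs
      have h3 : cos (φ r) ≠ 1 := fun hc => by
        obtain ⟨l, hl⟩ := (cos_eq_one_iff _).1 hc
        rw [← hl] at hr
        have e1 : ((k : ℝ) - 1) < l := by
          by_contra! hcon; nlinarith [hr.1]
        have e2 : (l : ℝ) < k + 1 := by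
          by_contra! hcon; nlinarith [hr.2]
        have e3 : k - 1 < l := by exact_mod_cast e1
        have e4 : l < k + 1 := by exact_mod_cast e2
        have : l = k := by omega
        subst this
        exact hrs (φmono.injective (hl.symm.trans hk.symm))
      have h4 := lt_of_le_of_ne (cos_le_one _) h3
      rw [γt, h1]
      simp only [ht]
      nlinarith
  have htadd : ∀ s, t (s + L) = t s := fun s => by simp only [ht, φadd, cos_add_two_pi]
  have hθadd : ∀ s, θ (s + L) = θ s + 2 * π := fun s => by simp only [hθ, φadd, hΘadd]
  refine ⟨γ, ⟨⟨h, fun s => ?_⟩, ?_⟩, ?_, ⟨?_, ?_⟩, htI⟩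
  · have h1 := hTsq s
    have h2 := (hf0 (t s)).ne'
    simp only [RotTorus.Curve.geodesicCurvature, RotTorus.metric,
      RotTorus.Curve.covariantAcceleration, RotTorus.Curve.normal, RotTorus.Curve.cosAngle,
      RotTorus.Curve.sinAngle, γt, γθ, dt, dθ, dT, dV]
    have h3 : T s ^ 2 + (u (t s) / M.f (t s)) ^ 2 = 1 := by rw [h1]; ring
    calc _ = h * (T s ^ 2 + (u (t s) / M.f (t s)) ^ 2) := by
          simp only [hV, hV', hA, hB']
          field_simp
          ring
      _ = h := by rw [h3, mul_one]
  · obtain ⟨s₀, hs₀⟩ := φsurj 0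
    obtain ⟨s₁, hs₁⟩ := φsurj π
    refine ⟨s₀, s₁, φmono.lt_iff_lt.1 (by rw [hs₀, hs₁]; exact pi_pos),
      (hmax s₀).2 ⟨0, by simp [hs₀]⟩, hsin1 _ (by simp [hs₀]), ?_, fun s hs => ?_,
      hsin1 _ (by simp [hs₁])⟩
    · rw [γt, dt, hT0, hs₁, sin_pi]
    · rw [γt, dt, Ne, hT0]
      have h1 := φmono hs.1
      have h2 := φmono hs.2
      rw [hs₀] at h1
      rw [hs₁] at h2
      exact (sin_pos_of_pos_of_lt_pi h1 h2).ne'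
  · refine ⟨L, hL, fun s => ?_, fun r s hrs => ?_⟩
    · simp only [RotTorus.Curve.point, γt, γθ, htadd, hθadd, AddCircle.coe_add_period]
    · have h1 := congrArg Prod.fst hrs
      simp only [RotTorus.Curve.point, γθ] at h1
      rw [← sub_eq_zero, ← AddCircle.coe_sub, AddCircle.coe_eq_zero_iff] at h1
      obtain ⟨n, hn⟩ := h1
      rw [zsmul_eq_mul] at hn
      -- The angle alone gives injectivity: `θ` is strictly increasing and gains exactly `2π` over
      -- each `L`, so equal angles modulo `2π` force parameters equal modulo `L`.
      have hp : Function.Periodic (fun s => θ s - 2 * π / L * s) L := fun s => by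
        simp only [hθadd]
        field_simp
        ring
      have h2 := hp.int_mul (-n) r
      refine ⟨-n, hθmono.injective ?_⟩
      have h3 : 2 * π / L * (((-n : ℤ) : ℝ) * L) = ((-n : ℤ) : ℝ) * (2 * π) := by field_simp
      simp only [mul_add, h3] at h2
      push_cast at h2 ⊢
      linarith
  · obtain ⟨s₀, hs₀⟩ := φsurj 0
    refine ⟨s₀, s₀ + L, by linarith, (hmax _).2 ⟨0, by simp [hs₀]⟩,
      (hmax _).2 ⟨1, by simp [φadd, hs₀]⟩, fun s hs => ?_⟩
    rw [hmax]
    rintro ⟨k, hk⟩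
    have h1 := φmono hs.1
    have h2 := φmono hs.2
    rw [hs₀, hk] at h1
    rw [φadd, hs₀, hk] at h2
    have e1 : (0 : ℝ) < k := by
      by_contra! hcon; nlinarith
    have e2 : (k : ℝ) < 1 := by
      by_contra! hcon; nlinarith
    have e3 : 0 < k := by exact_mod_cast e1
    have e4 : k < 1 := by exact_mod_cast e2
    omega
  · rintro s₀ s₁ ⟨hlt, h0, h1, hno⟩
    obtain ⟨k, hk⟩ := (hmax _).1 h0
    obtain ⟨l, hl⟩ := (hmax _).1 h1
    have hkl := φmono hlt
    rw [hk, hl] at hkl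
    have e1 : (k : ℝ) < l := by
      by_contra! hcon; nlinarith
    have e1' : k + 1 ≤ l := by
      have : k < l := by exact_mod_cast e1
      omega
    have e1'' : (k : ℝ) + 1 ≤ l := by exact_mod_cast e1'
    have hs : φ (s₀ + L) = ((k + 1 : ℤ) : ℝ) * (2 * π) := by rw [φadd, hk]; push_cast; ring
    -- The maxima are the points with `φ ∈ 2πℤ`, so `s₀ + L` is the first one after `s₀`.
    have hle : s₀ + L ≤ s₁ := φmono.le_iff_le.1 (by rw [hs, hl]; push_cast; nlinarith)
    rcases hle.eq_or_lt with he | he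
    · rw [γθ, ← he, hθadd, add_sub_cancel_left, abs_of_pos hpi]
    · exact absurd ((hmax _).2 ⟨_, hs⟩) (hno _ ⟨by linarith, he⟩)

/-! ### Secants of `f` and their divided differences. -/

/-- Second order Hadamard lemma: a `C²` function with two zeros `t₁ ≠ t₂` is
`(x - t₁) (x - t₂)` times a mean of its second derivative. -/
theorem eq_mul_mul_integral_of_zeros {k k' k'' : ℝ → ℝ} (hk : ∀ x, HasDerivAt k (k' x) x)
    (hk' : ∀ x, HasDerivAt k' (k'' x) x) (hc : Continuous k'') {t₁ t₂ : ℝ} (hne : t₁ ≠ t₂)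
    (h₁ : k t₁ = 0) (h₂ : k t₂ = 0) (x : ℝ) :
    k x = (x - t₁) * (x - t₂) *
      ∫ r in (0 : ℝ)..1, ∫ v in (0 : ℝ)..1, r * k'' (t₁ + r * (t₂ + v * (x - t₂) - t₁)) := by
  have hk'c : Continuous k' := continuous_iff_continuousAt.2 fun x => (hk' x).continuousAt
  have inner : ∀ r : ℝ, (x - t₂) *
      (∫ v in (0 : ℝ)..1, r * k'' (t₁ + r * (t₂ + v * (x - t₂) - t₁))) =
      k' (t₁ + r * (x - t₁)) - k' (t₁ + r * (t₂ - t₁)) := fun r => by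
    rw [← intervalIntegral.integral_const_mul]
    have hd : ∀ v ∈ Set.uIcc (0 : ℝ) 1, HasDerivAt
        (fun v => k' (t₁ + r * (t₂ + v * (x - t₂) - t₁)))
        ((x - t₂) * (r * k'' (t₁ + r * (t₂ + v * (x - t₂) - t₁)))) v := fun v _ => by
      have h1 : HasDerivAt (fun v : ℝ => t₁ + r * (t₂ + v * (x - t₂) - t₁)) (r * (x - t₂)) v := by
        simpa using (((((hasDerivAt_id v).mul_const (x - t₂)).const_add t₂).sub_const t₁).const_mul
          r).const_add t₁
      refine ((hk' _).comp v h1).congr_deriv (by ring)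
    rw [intervalIntegral.integral_eq_sub_of_hasDerivAt hd
      (Continuous.intervalIntegrable (by fun_prop) _ _)]
    congr 2 <;> ring
  have outer : ∀ y : ℝ, (y - t₁) * ∫ r in (0 : ℝ)..1, k' (t₁ + r * (y - t₁)) = k y := fun y => by
    rw [← intervalIntegral.integral_const_mul]
    have hd : ∀ r ∈ Set.uIcc (0 : ℝ) 1, HasDerivAt (fun r => k (t₁ + r * (y - t₁)))
        ((y - t₁) * k' (t₁ + r * (y - t₁))) r := fun r _ => by
      have h1 : HasDerivAt (fun r : ℝ => t₁ + r * (y - t₁)) (y - t₁) r := by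
        simpa using ((hasDerivAt_id r).mul_const (y - t₁)).const_add t₁
      refine ((hk _).comp r h1).congr_deriv (by ring)
    rw [intervalIntegral.integral_eq_sub_of_hasDerivAt hd
      (Continuous.intervalIntegrable (by fun_prop) _ _)]
    simp [h₁]
  -- The first divided difference at `t₁`, `t₂` vanishes; this is where the zeros must be distinct.
  have h3 : ∫ r in (0 : ℝ)..1, k' (t₁ + r * (t₂ - t₁)) = 0 := by
    have := outer t₂
    rw [h₂] at this
    exact (mul_eq_zero.1 this).resolve_left (sub_ne_zero.2 hne.symm)
  rw [mul_assoc, ← intervalIntegral.integral_const_mul]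
  simp only [inner]
  rw [intervalIntegral.integral_sub (Continuous.intervalIntegrable (by fun_prop) _ _)
    (Continuous.intervalIntegrable (by fun_prop) _ _), h3, sub_zero, outer]

section Secant

variable (f : ℝ → ℝ)

/-- The slope of the secant of `f` over `[m - a, m + a]` with respect to the variable `∫ f`; for
`a = 0` the slope of the tangent. -/
noncomputable def secantSlope (m a : ℝ) : ℝ :=
  (∫ r in (0 : ℝ)..1, deriv f (m - a + r * (2 * a))) / ∫ r in (0 : ℝ)..1, f (m - a + r * (2 * a))

/-- The secant of `f` over `[m - a, m + a]` with respect to the variable `∫ f`. -/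
noncomputable def secant (m a x : ℝ) : ℝ :=
  f (m - a) + secantSlope f m a * ∫ y in (m - a)..x, f y

/-- Minus the second divided difference of `f - secant f m a` at `m - a`, `m + a`, `x`. -/
noncomputable def secantGap (m a x : ℝ) : ℝ :=
  -∫ r in (0 : ℝ)..1, ∫ v in (0 : ℝ)..1,
    r * (deriv (deriv f) (m - a + r * (m + a + v * (x - (m + a)) - (m - a))) -
      secantSlope f m a * deriv f (m - a + r * (m + a + v * (x - (m + a)) - (m - a))))

variable {f}

theorem hasDerivAt_secant (hf : Continuous f) (m a x : ℝ) :
    HasDerivAt (secant f m a) (secantSlope f m a * f x) x :=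
  ((intervalIntegral.integral_hasDerivAt_right (hf.intervalIntegrable _ _)
    (hf.stronglyMeasurableAtFilter _ _) hf.continuousAt).const_mul _).const_add _

theorem secant_left (m a : ℝ) : secant f m a (m - a) = f (m - a) := by simp [secant]

theorem integral_pos_unit {g : ℝ → ℝ} (hg : Continuous g) (h0 : ∀ x, 0 < g x) :
    0 < ∫ r in (0 : ℝ)..1, g r :=
  intervalIntegral.intervalIntegral_pos_of_pos (hg.intervalIntegrable _ _) h0 one_pos

theorem secant_right (hf : ContDiff ℝ 1 f) (h0 : ∀ x, 0 < f x) (m a : ℝ) :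
    secant f m a (m + a) = f (m + a) := by
  have hfc := hf.continuous
  have hf'c := hf.continuous_deriv le_rfl
  have e1 : ∫ y in (m - a)..(m + a), f y = 2 * a * ∫ r in (0 : ℝ)..1, f (m - a + r * (2 * a)) := by
    have := intervalIntegral.mul_integral_comp_add_mul (f := f) (a := 0) (b := 1) (2 * a) (m - a)
    rw [mul_zero, mul_one, add_zero, show m - a + 2 * a = m + a by ring] at this
    rw [← this]
    simp only [mul_comm]
  have e2 : f (m + a) - f (m - a) =
      2 * a * ∫ r in (0 : ℝ)..1, deriv f (m - a + r * (2 * a)) := by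
    have := intervalIntegral.mul_integral_comp_add_mul (f := deriv f) (a := 0) (b := 1) (2 * a)
      (m - a)
    rw [mul_zero, mul_one, add_zero, show m - a + 2 * a = m + a by ring,
      intervalIntegral.integral_deriv_eq_sub
        (fun x _ => hf.differentiable one_ne_zero x) (hf'c.intervalIntegrable _ _)] at this
    rw [← this]
    simp only [mul_comm]
  have e3 := (integral_pos_unit (g := fun r => f (m - a + r * (2 * a))) (by fun_prop)
    fun r => h0 _).ne'
  rw [secant, secantSlope, e1, mul_left_comm, div_mul_cancel₀ _ e3, ← e2, add_sub_cancel]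

/-- The Hadamard factor at `x = m + a c` is `(a c + a) (a c - a) = -a² (1 - c²)`, whose sign is
absorbed in `secantGap`. With `c = cos φ` this extracts the factor `(a sin φ)²`. -/
theorem sub_secant_eq (hf : ContDiff ℝ 2 f) (h0 : ∀ x, 0 < f x) {m a : ℝ} (ha : a ≠ 0)
    (c : ℝ) : f (m + a * c) - secant f m a (m + a * c) =
      a ^ 2 * (1 - c ^ 2) * secantGap f m a (m + a * c) := by
  have hf1 : ContDiff ℝ 1 f := hf.of_le (by norm_num)
  have hf' : ContDiff ℝ 1 (deriv f) := (contDiff_succ_iff_deriv (n := 1) |>.1 hf).2.2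
  have hd : ∀ x, HasDerivAt f (deriv f x) x := fun x =>
    (hf1.differentiable one_ne_zero x).hasDerivAt
  have hd' : ∀ x, HasDerivAt (deriv f) (deriv (deriv f) x) x := fun x =>
    (hf'.differentiable one_ne_zero x).hasDerivAt
  have hf'c := hf1.continuous_deriv le_rfl
  have hf''c := hf'.continuous_deriv le_rfl
  have := eq_mul_mul_integral_of_zeros (k := fun x => f x - secant f m a x)
    (fun x => (hd x).sub (hasDerivAt_secant hf.continuous m a x))
    (fun x => (hd' x).sub ((hd x).const_mul (secantSlope f m a)))
    (by fun_prop) (t₁ := m - a) (t₂ := m + a) (fun h => ha (by linarith))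
    (by simp only [secant_left, sub_self]) (by simp only [secant_right hf1 h0, sub_self])
    (m + a * c)
  rw [this, secantGap]
  ring

/-- Numerator and denominator are means over the unit interval rather than differences, so `a = 0`
is not singular. -/
theorem continuous_secantSlope (hf : ContDiff ℝ 1 f) (h0 : ∀ x, 0 < f x) :
    Continuous fun p : ℝ × ℝ => secantSlope f p.1 p.2 := by
  have hfc := hf.continuous
  have hf'c := hf.continuous_deriv le_rfl
  refine Continuous.div ?_ ?_ fun p => (integral_pos_unit (by fun_prop) fun r => h0 _).ne'
  · exact intervalIntegral.continuous_parametric_intervalIntegral_of_continuous' (by fun_prop) _ _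
  · exact intervalIntegral.continuous_parametric_intervalIntegral_of_continuous' (by fun_prop) _ _

theorem continuous_secant (hf : ContDiff ℝ 1 f) (h0 : ∀ x, 0 < f x) :
    Continuous fun p : ℝ × ℝ × ℝ => secant f p.1 p.2.1 p.2.2 := by
  have hfc := hf.continuous
  have hs := continuous_secantSlope hf h0
  have h1 : Continuous fun p : ℝ × ℝ × ℝ => secantSlope f p.1 p.2.1 :=
    hs.comp (continuous_fst.prodMk (continuous_fst.comp continuous_snd))
  have h2 : Continuous fun p : ℝ × ℝ × ℝ => ∫ y in (p.1 - p.2.1)..p.2.2, f y := by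
    have h3 : Continuous fun x => ∫ y in (0 : ℝ)..x, f y :=
      continuous_iff_continuousAt.2 fun x => (hasDerivAt_integral_of_continuous hfc x).continuousAt
    have h4 : (fun p : ℝ × ℝ × ℝ => ∫ y in (p.1 - p.2.1)..p.2.2, f y) = fun p =>
        (∫ y in (0 : ℝ)..p.2.2, f y) - ∫ y in (0 : ℝ)..(p.1 - p.2.1), f y := funext fun p =>
      (intervalIntegral.integral_interval_sub_left (hfc.intervalIntegrable _ _)
        (hfc.intervalIntegrable _ _)).symm
    rw [h4]
    exact (h3.comp (by fun_prop)).sub (h3.comp (by fun_prop))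
  unfold secant
  exact (by fun_prop : Continuous fun p : ℝ × ℝ × ℝ => f (p.1 - p.2.1)).add (h1.mul h2)

theorem continuous_secantGap (hf : ContDiff ℝ 2 f) (h0 : ∀ x, 0 < f x) :
    Continuous fun p : ℝ × ℝ × ℝ => secantGap f p.1 p.2.1 p.2.2 := by
  have hf1 : ContDiff ℝ 1 f := hf.of_le (by norm_num)
  have hf' : ContDiff ℝ 1 (deriv f) := (contDiff_succ_iff_deriv (n := 1) |>.1 hf).2.2
  have hf'c := hf1.continuous_deriv le_rfl
  have hf''c := hf'.continuous_deriv le_rfl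
  have hs := continuous_secantSlope hf1 h0
  have h1 : Continuous fun p : ((ℝ × ℝ × ℝ) × ℝ) × ℝ => secantSlope f p.1.1.1 p.1.1.2.1 :=
    hs.comp (g := fun p : ℝ × ℝ => secantSlope f p.1 p.2)
      (f := fun p : ((ℝ × ℝ × ℝ) × ℝ) × ℝ => (p.1.1.1, p.1.1.2.1)) (by fun_prop)
  unfold secantGap
  refine Continuous.neg ?_
  refine intervalIntegral.continuous_parametric_intervalIntegral_of_continuous' ?_ _ _
  refine intervalIntegral.continuous_parametric_intervalIntegral_of_continuous'
    (X := (ℝ × ℝ × ℝ) × ℝ) (f := fun q v => q.2 * (deriv (deriv f) (q.1.1 - q.1.2.1 + q.2 *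
      (q.1.1 + q.1.2.1 + v * (q.1.2.2 - (q.1.1 + q.1.2.1)) - (q.1.1 - q.1.2.1))) -
      secantSlope f q.1.1 q.1.2.1 * deriv f (q.1.1 - q.1.2.1 + q.2 *
      (q.1.1 + q.1.2.1 + v * (q.1.2.2 - (q.1.1 + q.1.2.1)) - (q.1.1 - q.1.2.1))))) ?_ _ _
  refine Continuous.mul (by fun_prop) (Continuous.sub (by fun_prop) (Continuous.mul h1 ?_))
  fun_prop

theorem secantSlope_zero (m : ℝ) : secantSlope f m 0 = deriv f m / f m := by
  simp [secantSlope]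

theorem secant_zero (m : ℝ) : secant f m 0 m = f m := by
  simp [secant]

/-- Multiplied by `f + u = 2 f`, this is the limit `f'² - f f''` of `E` as `a → 0`. -/
theorem secantGap_zero (h0 : ∀ x, 0 < f x) (m : ℝ) :
    secantGap f m 0 m = (deriv f m ^ 2 - f m * deriv (deriv f) m) / (2 * f m) := by
  have := (h0 m).ne'
  simp [secantGap, secantSlope_zero]
  field_simp
  ring

end Secant

/-! ### The period integral and its limit for short secants. -/

open Real in
/-- If `f'² - f f''` takes values on both sides of `1`, then some arbitrarily short secant of `f`
has period integral `2π`. -/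
theorem exists_secant_period_eq_two_pi {f : ℝ → ℝ} (hf : ContDiff ℝ 2 f) (h0 : ∀ x, 0 < f x)
    {x y : ℝ} (hq : ∀ m ∈ Set.uIcc x y, 0 < deriv f m ^ 2 - f m * deriv (deriv f) m)
    (hx : deriv f x ^ 2 - f x * deriv (deriv f) x < 1)
    (hy : 1 < deriv f y ^ 2 - f y * deriv (deriv f) y) {ε : ℝ} (hε : 0 < ε) :
    ∃ m ∈ Set.uIcc x y, ∃ a, 0 < a ∧ a < ε ∧ ∃ E : ℝ → ℝ, Continuous E ∧ (∀ φ, 0 < E φ) ∧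
      Function.Periodic E (2 * π) ∧
      (∀ φ, f (m + a * cos φ) ^ 2 - secant f m a (m + a * cos φ) ^ 2 = (a * sin φ) ^ 2 * E φ) ∧
      (∀ φ, 0 < secant f m a (m + a * cos φ)) ∧
      ∫ φ in (0 : ℝ)..(2 * π),
        secant f m a (m + a * cos φ) / (f (m + a * cos φ) * √(E φ)) = 2 * π := by
  have hf1 : ContDiff ℝ 1 f := hf.of_le (by norm_num)
  have hf' : ContDiff ℝ 1 (deriv f) := (contDiff_succ_iff_deriv (n := 1) |>.1 hf).2.2
  have hfc := hf.continuous
  have hf'c := hf1.continuous_deriv le_rfl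
  have hf''c := hf'.continuous_deriv le_rfl
  set q : ℝ → ℝ := fun m => deriv f m ^ 2 - f m * deriv (deriv f) m with hqdef
  have hqc : Continuous q := by fun_prop
  -- a positive lower bound for `q`
  obtain ⟨m₀, hm₀, hmin⟩ := isCompact_uIcc.exists_isMinOn (s := Set.uIcc x y)
    ⟨x, Set.left_mem_uIcc⟩ hqc.continuousOn
  set η := q m₀ / 2 with hη
  have hη0 : 0 < η := half_pos (hq m₀ hm₀)
  have hηq : ∀ m ∈ Set.uIcc x y, η < q m := fun m hm =>
    (half_lt_self (hq m₀ hm₀)).trans_le (hmin hm)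
  -- the quantities as functions of `((m, c), a)` with `c = cos φ`
  have hu : Continuous fun p : (ℝ × ℝ) × ℝ => secant f p.1.1 p.2 (p.1.1 + p.2 * p.1.2) :=
    (continuous_secant hf1 h0).comp (f := fun p : (ℝ × ℝ) × ℝ =>
      (p.1.1, p.2, p.1.1 + p.2 * p.1.2)) (by fun_prop)
  have hD : Continuous fun p : (ℝ × ℝ) × ℝ => secantGap f p.1.1 p.2 (p.1.1 + p.2 * p.1.2) :=
    (continuous_secantGap hf h0).comp (f := fun p : (ℝ × ℝ) × ℝ =>
      (p.1.1, p.2, p.1.1 + p.2 * p.1.2)) (by fun_prop)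
  set e : (ℝ × ℝ) × ℝ → ℝ := fun p => secantGap f p.1.1 p.2 (p.1.1 + p.2 * p.1.2) *
    (f (p.1.1 + p.2 * p.1.2) + secant f p.1.1 p.2 (p.1.1 + p.2 * p.1.2)) with he
  have hec : Continuous e := hD.mul (Continuous.add (by fun_prop) hu)
  have he0 : ∀ m c, e ((m, c), 0) = q m := fun m c => by
    have := (h0 m).ne'
    simp only [he, zero_mul, add_zero, secantGap_zero h0, secant_zero, hqdef]
    field_simp
    ring
  have hopen : IsOpen {p : (ℝ × ℝ) × ℝ | η < e p ∧
      0 < secant f p.1.1 p.2 (p.1.1 + p.2 * p.1.2)} :=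
    (isOpen_lt continuous_const hec).inter (isOpen_lt continuous_const hu)
  -- Both inequalities hold at `a = 0`; compactness in `m` and `c` gives one neighbourhood `B` of
  -- `0` for all centres and all `φ`.
  obtain ⟨A, B, -, hB, hA, h0B, hAB⟩ := generalized_tube_lemma
    ((isCompact_uIcc (a := x) (b := y)).prod (isCompact_Icc (a := (-1 : ℝ)) (b := 1)))
    (isCompact_singleton (x := (0 : ℝ))) hopen (by
      rintro ⟨⟨m, c⟩, a⟩ ⟨⟨hm, -⟩, ha⟩
      obtain rfl : a = 0 := ha
      refine ⟨?_, ?_⟩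
      · rw [he0]; exact hηq m hm
      · simp only [zero_mul, add_zero, secant_zero, h0])
  -- the period integral
  set P : ℝ × ℝ → ℝ := fun p => ∫ φ in (0 : ℝ)..(2 * π),
    secant f p.1 p.2 (p.1 + p.2 * cos φ) /
      (f (p.1 + p.2 * cos φ) * √(max η (e ((p.1, cos φ), p.2)))) with hP
  -- Truncating `e` below at `η` makes the integrand continuous for all `(m, a)`; on the tube the
  -- truncation has no effect.
  have hmax : ∀ z, 0 < √(max η z) := fun z => sqrt_pos.2 (lt_max_of_lt_left hη0)
  have hPc : Continuous P := by
    refine intervalIntegral.continuous_parametric_intervalIntegral_of_continuous' ?_ _ _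
    have h1 : Continuous fun r : (ℝ × ℝ) × ℝ => ((r.1.1, cos r.2), r.1.2) := by fun_prop
    refine Continuous.div (hu.comp h1) (Continuous.mul (by fun_prop)
      (continuous_sqrt.comp (continuous_const.max (hec.comp h1)))) fun r =>
      (mul_pos (h0 _) (hmax _)).ne'
  have hP0 : ∀ m ∈ Set.uIcc x y, P (m, 0) = 2 * π / √(q m) := fun m hm => by
    have := (h0 m).ne'
    simp only [hP, he0, zero_mul, add_zero, secant_zero, max_eq_right (hηq m hm).le,
      intervalIntegral.integral_const, smul_eq_mul, sub_zero]
    field_simp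
  have hxlim : ∀ᶠ a in 𝓝[>] (0 : ℝ), 2 * π < P (x, a) := by
    refine nhdsWithin_le_nhds ((Continuous.continuousAt (x := (0 : ℝ))
      (f := fun a => P (x, a)) (by fun_prop)).eventually (lt_mem_nhds ?_))
    beta_reduce
    rw [hP0 x Set.left_mem_uIcc, lt_div_iff₀ (sqrt_pos.2 (hq x Set.left_mem_uIcc))]
    have : √(q x) < 1 := by rw [sqrt_lt' one_pos]; simpa using hx
    nlinarith [two_pi_pos]
  have hylim : ∀ᶠ a in 𝓝[>] (0 : ℝ), P (y, a) < 2 * π := by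
    refine nhdsWithin_le_nhds ((Continuous.continuousAt (x := (0 : ℝ))
      (f := fun a => P (y, a)) (by fun_prop)).eventually (gt_mem_nhds ?_))
    beta_reduce
    rw [hP0 y Set.right_mem_uIcc, div_lt_iff₀ (sqrt_pos.2 (hq y Set.right_mem_uIcc))]
    have : 1 < √(q y) := by rw [lt_sqrt zero_le_one]; simpa using hy
    nlinarith [two_pi_pos]
  have hBlim : ∀ᶠ a in 𝓝[>] (0 : ℝ), a ∈ B :=
    nhdsWithin_le_nhds (hB.mem_nhds (h0B rfl))
  obtain ⟨a, hax, hay, haB, ha⟩ := (hxlim.and <| hylim.and <| hBlim.and <|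
    Ioo_mem_nhdsGT hε).exists
  -- The half-width `a > 0` is fixed and only the centre `m` varies.
  obtain ⟨m, hm, hPm⟩ := intermediate_value_uIcc (f := fun m => P (m, a))
    (Continuous.continuousOn (by fun_prop) : ContinuousOn _ (Set.uIcc x y))
    (show 2 * π ∈ Set.uIcc (P (x, a)) (P (y, a)) from Set.mem_uIcc_of_ge hay.le hax.le)
  have hloc : ∀ φ, η < e ((m, cos φ), a) ∧ 0 < secant f m a (m + a * cos φ) := fun φ =>
    hAB (a := ((m, cos φ), a)) ⟨hA ⟨hm, neg_one_le_cos φ, cos_le_one φ⟩, haB⟩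
  refine ⟨m, hm, a, ha.1, ha.2, fun φ => max η (e ((m, cos φ), a)), ?_,
    fun φ => lt_max_of_lt_left hη0, fun φ => by simp only [cos_add_two_pi], fun φ => ?_,
    fun φ => (hloc φ).2, hPm⟩
  · exact continuous_const.max (hec.comp (by fun_prop))
  · beta_reduce
    rw [max_eq_right (hloc φ).1.le, sq_sub_sq, sub_secant_eq hf h0 ha.1.ne', mul_pow, sin_sq]
    simp only [he]
    ring

/-! ### Strict monotonicity and a cut-off. -/

/-- If `K` is strictly decreasing and `q' = w K'` with `w > 0`, then `q` is strictly decreasing. -/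
theorem StrictAntiOn.of_hasDerivAt_mul {K q K' w : ℝ → ℝ} {a b : ℝ}
    (hK : StrictAntiOn K (Set.Ioo a b)) (hK' : ∀ x ∈ Set.Ioo a b, HasDerivAt K (K' x) x)
    (hq : ∀ x ∈ Set.Ioo a b, HasDerivAt q (w x * K' x) x) (hw : ∀ x ∈ Set.Ioo a b, 0 < w x) :
    StrictAntiOn q (Set.Ioo a b) := by
  have hK0 : ∀ x ∈ Set.Ioo a b, K' x ≤ 0 := fun x hx => by
    have h1 := hK.antitoneOn.derivWithin_nonpos (x := x)
    rwa [derivWithin_of_isOpen isOpen_Ioo hx, (hK' x hx).deriv] at h1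
  have hanti : AntitoneOn q (Set.Ioo a b) := by
    refine antitoneOn_of_deriv_nonpos (convex_Ioo a b)
      (fun x hx => (hq x hx).continuousAt.continuousWithinAt) ?_ ?_
    · rw [interior_Ioo]
      exact fun x hx => (hq x hx).differentiableAt.differentiableWithinAt
    · rw [interior_Ioo]
      intro x hx
      rw [(hq x hx).deriv]
      exact mul_nonpos_of_nonneg_of_nonpos (hw x hx).le (hK0 x hx)
  intro x hx y hy hxy
  -- `K'` may vanish at some points, so strictness is argued by contradiction: `q x = q y` would
  -- make `q` constant on `[x, y]`, while the mean value theorem gives a point there with `K' < 0`,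
  -- hence `q' < 0`.
  refine lt_of_le_of_ne (hanti hx hy hxy.le) fun heq => ?_
  have hsub : Set.Icc x y ⊆ Set.Ioo a b := fun z hz =>
    ⟨hx.1.trans_le hz.1, hz.2.trans_lt hy.2⟩
  obtain ⟨z, hz, hzK⟩ := exists_hasDerivAt_eq_slope K K' hxy
    (fun z hz => (hK' z (hsub hz)).continuousAt.continuousWithinAt)
    (fun z hz => hK' z (hsub (Set.Ioo_subset_Icc_self hz)))
  have hz' := hsub (Set.Ioo_subset_Icc_self hz)
  have hneg : K' z < 0 := by
    rw [hzK]
    exact div_neg_of_neg_of_pos (sub_neg.2 (hK hx hy hxy)) (sub_pos.2 hxy)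
  have hconst : q =ᶠ[𝓝 z] fun _ => q x := by
    filter_upwards [Ioo_mem_nhds hz.1 hz.2] with r hr
    have hr' := hsub (Set.Ioo_subset_Icc_self hr)
    exact le_antisymm (hanti hx hr' hr.1.le) (heq ▸ hanti hr' hy hr.2.le)
  have := (hq z hz').unique ((hasDerivAt_const z (q x)).congr_of_eventuallyEq hconst)
  exact (mul_neg_of_pos_of_neg (hw z hz') hneg).ne this

/-- A continuous function with negative derivative off a finite set is decreasing. -/
theorem lt_of_deriv_neg_off_finset (S : Finset ℝ) {g : ℝ → ℝ} (hg : Continuous g) {a b : ℝ}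
    (hab : a < b) (h : ∀ t ∈ Set.Ioo a b, t ∉ S → deriv g t < 0) : g b < g a := by
  induction S using Finset.induction_on generalizing a b with
  | empty =>
    refine strictAntiOn_of_deriv_neg (convex_Icc a b) hg.continuousOn (fun t ht => ?_)
      (Set.left_mem_Icc.2 hab.le) (Set.right_mem_Icc.2 hab.le) hab
    rw [interior_Icc] at ht
    exact h t ht (Finset.notMem_empty t)
  | insert s S _ ih =>
    by_cases hs : s ∈ Set.Ioo a b
    · refine (ih hs.2 fun t ht htS => ?_).trans (ih hs.1 fun t ht htS => ?_)
      · refine h t ⟨hs.1.trans ht.1, ht.2⟩ fun hmem => ?_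
        exact (Finset.mem_insert.1 hmem).elim ht.1.ne' htS
      · refine h t ⟨ht.1, ht.2.trans hs.2⟩ fun hmem => ?_
        exact (Finset.mem_insert.1 hmem).elim ht.2.ne htS
    · refine ih hab fun t ht htS => h t ht fun hmem => ?_
      exact (Finset.mem_insert.1 hmem).elim (fun e => hs (e ▸ ht)) htS

/-- A positive function that is `C²` near a closed ball agrees on the ball with a positive `C²`
function on the line. -/
theorem exists_contDiff_two_eqOn_ball {f : ℝ → ℝ} (h0 : ∀ x, 0 < f x) {c r R : ℝ} (hr : 0 < r)
    (hrR : r < R) (hf : ∀ x ∈ Metric.closedBall c R, ContDiffAt ℝ 2 f x) :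
    ∃ g : ℝ → ℝ, ContDiff ℝ 2 g ∧ (∀ x, 0 < g x) ∧ Set.EqOn g f (Metric.ball c r) := by
  let χ : ContDiffBump c := ⟨r, R, hr, hrR⟩
  -- A convex combination of `f` and the constant `1` stays positive.
  refine ⟨fun x => χ x * f x + (1 - χ x), contDiff_iff_contDiffAt.2 fun x => ?_, fun x => ?_,
    fun x hx => ?_⟩
  · by_cases hx : x ∈ Metric.closedBall c R
    · exact (χ.contDiff.contDiffAt.mul (hf x hx)).add (contDiffAt_const.sub χ.contDiff.contDiffAt)
    · refine (contDiffAt_const (c := (1 : ℝ))).congr_of_eventuallyEq ?_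
      filter_upwards [Metric.isClosed_closedBall.isOpen_compl.mem_nhds hx] with y hy
      have : χ y = 0 := χ.zero_of_le_dist (by
        have h1 : ¬ dist y c ≤ R := hy
        exact (not_le.1 h1).le)
      simp [this]
  · have h1 := χ.nonneg (x := x)
    have h2 := χ.le_one (x := x)
    rcases h2.eq_or_lt with h3 | h3
    · simp [h3, h0 x]
    · have := mul_nonneg h1 (h0 x).le
      linarith
  · have : χ x = 1 := χ.one_of_mem_closedBall (Metric.ball_subset_closedBall hx)
    simp [this]

/-! ### Curvature and the function `f'² - f f''`. -/

namespace RotTorus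

variable (M : RotTorus)

theorem periodic_deriv : Function.Periodic (deriv M.f) (2 * M.t0) := fun x => by
  rw [← deriv_comp_add_const]
  congr 1
  exact funext M.f_periodic

theorem deriv_f_neg_t0 : deriv M.f (-M.t0) = 0 := by
  have := M.periodic_deriv (-M.t0)
  rwa [show -M.t0 + 2 * M.t0 = M.t0 by ring, M.deriv_f_t0, eq_comm] at this

theorem deriv_deriv_f (t : ℝ) : deriv (deriv M.f) t = -M.K t * M.f t := by
  have := (M.f_pos t).ne'
  rw [K]
  field_simp

/-- If the curvature is decreasing, then `f'^2 - f f'' = 1` does not hold on the parallel `𝕊¹ × {t0}`. -/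
theorem mem_Ioo_of_decreasing_of_eq_one (hdec : M.CurvatureDecreasing) {τ : ℝ}
    (hτ : τ ∈ Set.Icc (-M.t0) M.t0) (hC : ContDiffAt ℝ 2 M.f τ)
    (hq : deriv M.f τ ^ 2 - M.f τ * deriv (deriv M.f) τ = 1) : τ ∈ Set.Ioo (-M.t0) M.t0 := by
  by_contra hcon
  have hends : τ = -M.t0 ∨ τ = M.t0 := by
    rw [Set.mem_Ioo, not_and_or, not_lt, not_lt] at hcon
    exact hcon.imp (fun h => le_antisymm h hτ.1) fun h => le_antisymm hτ.2 h
  have habs : |τ| = M.t0 := by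
    rcases hends with rfl | rfl
    · rw [abs_neg, abs_of_pos M.t0_pos]
    · exact abs_of_pos M.t0_pos
  have hd : deriv M.f τ = 0 := by
    rcases hends with rfl | rfl
    · exact M.deriv_f_neg_t0
    · exact M.deriv_f_t0
  -- At an end `f' = 0`, so the equation reads `f² K = 1`. There `|t|` is maximal, so `K ≥ K τ > 0`
  -- wherever `f` is `C²`; then `f'` strictly decreases from `-t0` to `t0`, although it vanishes at
  -- both.
  have hK : 0 < M.K τ := by
    have h1 := M.f_pos τ
    rw [hd, M.deriv_deriv_f] at hq
    by_contra! h2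
    nlinarith [mul_nonneg (mul_nonneg h1.le h1.le) (neg_nonneg.2 h2)]
  obtain ⟨S, hS, hSC⟩ := M.f_piecewise
  have hlt := lt_of_deriv_neg_off_finset hS.toFinset (M.f_contDiff.continuous_deriv le_rfl)
    (neg_lt_self M.t0_pos) fun t ht htS => by
      have htI := Set.Ioo_subset_Icc_self ht
      have h1 := hdec t htI τ hτ (hSC t htI fun h => htS (hS.mem_toFinset.2 h)) hC
        (habs ▸ abs_le.2 htI)
      rw [M.deriv_deriv_f]
      nlinarith [M.f_pos t]
  rw [M.deriv_f_t0, M.deriv_f_neg_t0] at hlt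
  exact lt_irrefl _ hlt

end RotTorus

namespace RotTorus

variable (M : RotTorus)

/-- The function `f'² - f f''` of the height, with derivative `f² K'` where the curvature is smooth. -/
noncomputable def q (t : ℝ) : ℝ := deriv M.f t ^ 2 - M.f t * deriv (deriv M.f) t

theorem hasDerivAt_q {t K' : ℝ} (hC : ContDiffAt ℝ 2 M.f t) (hK : HasDerivAt M.K K' t) :
    HasDerivAt M.q (M.f t ^ 2 * K') t := by
  have h1 : HasDerivAt M.f (deriv M.f t) t :=
    (M.f_contDiff.differentiable one_ne_zero t).hasDerivAt
  have h2 : HasDerivAt (deriv M.f) (-M.K t * M.f t) t := by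
    rw [← M.deriv_deriv_f]
    have h : ContDiffAt ℝ 1 (fun s => fderiv ℝ M.f s 1) t :=
      (hC.fderiv_right (m := 1) (by norm_num)).clm_apply contDiffAt_const
    exact (h.differentiableAt one_ne_zero).hasDerivAt
  have h3 : M.q = fun t => deriv M.f t ^ 2 + M.f t ^ 2 * M.K t := funext fun s => by
    rw [q, M.deriv_deriv_f]; ring
  rw [h3]
  refine ((h2.pow 2).add ((h1.pow 2).mul hK)).congr_deriv ?_
  simp only [Pi.pow_apply]
  push_cast
  ring

/-- Near a parallel different from `𝕊¹ × {0}` with `f'² - f f'' = 1`, where the curvature is strictly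
decreasing in `|t|`, the function `f'² - f f''` takes values on both sides of `1`. -/
theorem exists_q_lt_one_lt_q {τ δ : ℝ} (hδ : 0 < δ) {U : Set ℝ} (hU : IsOpen U)
    (hδU : Set.Ioo (τ - δ) (τ + δ) ⊆ U ∩ Set.Icc (-M.t0) M.t0) (hδτ : δ < |τ|)
    (hq : M.q τ = 1) (hsmooth : M.CurvatureSmoothOn U) (hstrict : M.CurvatureStrictlyDecreasingOn U) :
    ∃ x ∈ Set.Ioo (τ - δ) (τ + δ), ∃ y ∈ Set.Ioo (τ - δ) (τ + δ), M.q x < 1 ∧ 1 < M.q y := by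
  have hK : ∀ x ∈ Set.Ioo (τ - δ) (τ + δ), HasDerivAt M.K (deriv M.K x) x := fun x hx =>
    ((hsmooth.2.contDiffAt (hU.mem_nhds (hδU hx).1)).differentiableAt (by simp)).hasDerivAt
  have hq' : ∀ x ∈ Set.Ioo (τ - δ) (τ + δ), HasDerivAt M.q (M.f x ^ 2 * deriv M.K x) x :=
    fun x hx => M.hasDerivAt_q (hsmooth.1 x (hδU hx).1) (hK x hx)
  have hf2 : ∀ x ∈ Set.Ioo (τ - δ) (τ + δ), 0 < M.f x ^ 2 := fun x _ => pow_pos (M.f_pos x) 2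
  have hl : τ - δ / 2 ∈ Set.Ioo (τ - δ) (τ + δ) := by constructor <;> linarith
  have hm : τ ∈ Set.Ioo (τ - δ) (τ + δ) := by constructor <;> linarith
  have hr : τ + δ / 2 ∈ Set.Ioo (τ - δ) (τ + δ) := by constructor <;> linarith
  rcases le_or_gt 0 τ with h | h
  · rw [abs_of_nonneg h] at hδτ
    have hanti : StrictAntiOn M.K (Set.Ioo (τ - δ) (τ + δ)) := fun x hx y hy hxy =>
      hstrict x (hδU hx) y (hδU hy) (by
        rw [abs_of_pos (by linarith [hx.1]), abs_of_pos (by linarith [hy.1])]; exact hxy)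
    have hqa := hanti.of_hasDerivAt_mul hK hq' hf2
    exact ⟨_, hr, _, hl, hq ▸ hqa hm hr (by linarith), hq ▸ hqa hl hm (by linarith)⟩
  -- For `τ < 0` the curvature increases with `t`, so the monotonicity lemma is applied to `-K` and
  -- `-q`.
  · rw [abs_of_neg h] at hδτ
    have hanti : StrictAntiOn (-M.K) (Set.Ioo (τ - δ) (τ + δ)) := fun x hx y hy hxy =>
      neg_lt_neg <| hstrict y (hδU hy) x (hδU hx) (by
        rw [abs_of_neg (by linarith [hy.2] : y < 0), abs_of_neg (by linarith [hx.2] : x < 0)]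
        linarith)
    have hqa := hanti.of_hasDerivAt_mul (q := -M.q) (fun x hx => (hK x hx).neg)
      (fun x hx => (hq' x hx).neg.congr_deriv (mul_neg _ _).symm) hf2
    exact ⟨_, hl, _, hr, hq ▸ neg_lt_neg_iff.1 (hqa hl hm (by linarith)),
      hq ▸ neg_lt_neg_iff.1 (hqa hm hr (by linarith))⟩

end RotTorus

/-! ### Localization near `τ` and conclusion. -/

theorem mainTheorem4 (M : RotTorus) (hsym : M.HorizontallySymmetric)
    (hdec : M.CurvatureDecreasing)
    (τ : ℝ) (hτ : τ ∈ Set.Icc (-M.t0) M.t0) (hτ0 : τ ≠ 0)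
    (hq : deriv M.f τ ^ 2 - M.f τ * deriv (deriv M.f) τ = 1)
    (U : Set ℝ) (hU : IsOpen U) (hτU : τ ∈ U)
    (hsmooth : M.CurvatureSmoothOn U) (hstrict : M.CurvatureStrictlyDecreasingOn U) :
    ∀ ε > 0, ∃ γ : M.Curve, γ.IsUnduloidType ∧ γ.IsClosedEmbedded ∧
      γ.HasPeriod (2 * Real.pi) ∧ ∀ s, |γ.t s - τ| < ε := by
  intro ε hε
  have hτC := hsmooth.1 τ hτU
  have hτI := M.mem_Ioo_of_decreasing_of_eq_one hdec hτ hτC hq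
  have hqc : ContinuousAt M.q τ := (M.hasDerivAt_q hτC ((hsmooth.2.contDiffAt
    (hU.mem_nhds hτU)).differentiableAt (by simp)).hasDerivAt).continuousAt
  have hqpos : ∀ᶠ t in 𝓝 τ, 0 < M.q t :=
    continuousAt_const.eventually_lt hqc (by rw [RotTorus.q, hq]; exact one_pos)
  obtain ⟨ρ, hρ, hball⟩ := Metric.eventually_nhds_iff_ball.1
    ((hU.eventually_mem hτU).and ((isOpen_Ioo.eventually_mem hτI).and hqpos))
  -- a symmetric interval of radius `4 δ` around `τ` on which everything is regular
  set δ := min ρ (min ε |τ|) / 8 with hδ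
  have hmin : 0 < min ρ (min ε |τ|) := lt_min hρ (lt_min hε (abs_pos.2 hτ0))
  have hδ0 : 0 < δ := by positivity
  have hδρ : 8 * δ ≤ ρ := by rw [hδ]; linarith [min_le_left ρ (min ε |τ|)]
  have hδε : 8 * δ ≤ ε := by
    rw [hδ]; linarith [(min_le_right ρ (min ε |τ|)).trans (min_le_left _ _)]
  have hδτ : 8 * δ ≤ |τ| := by
    rw [hδ]; linarith [(min_le_right ρ (min ε |τ|)).trans (min_le_right _ _)]
  have hreg : ∀ t, |t - τ| < 8 * δ → t ∈ U ∧ t ∈ Set.Ioo (-M.t0) M.t0 ∧ 0 < M.q t :=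
    fun t ht => hball t (by rw [Metric.mem_ball, Real.dist_eq]; linarith)
  obtain ⟨x, hx, y, hy, hqx, hqy⟩ := M.exists_q_lt_one_lt_q hδ0 hU
    (fun t ht => by
      have := hreg t (by rw [abs_lt]; constructor <;> linarith [ht.1, ht.2])
      exact ⟨this.1, Set.Ioo_subset_Icc_self this.2.1⟩)
    (by linarith) hq hsmooth hstrict
  -- replace `f` by a globally `C²` function
  obtain ⟨g, hg, hg0, hgf⟩ := exists_contDiff_two_eqOn_ball M.f_pos (c := τ) (r := 3 * δ)
    (R := 4 * δ) (by linarith) (by linarith) fun t ht => hsmooth.1 t (hreg t (by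
      rw [Metric.mem_closedBall, Real.dist_eq] at ht
      linarith)).1
  have hev : ∀ t, |t - τ| < 3 * δ → g =ᶠ[𝓝 t] M.f := fun t ht =>
    hgf.eventuallyEq_of_mem (Metric.isOpen_ball.mem_nhds (by
      rwa [Metric.mem_ball, Real.dist_eq]))
  have hgq : ∀ t, |t - τ| < 3 * δ → deriv g t ^ 2 - g t * deriv (deriv g) t = M.q t :=
    fun t ht => by
      rw [RotTorus.q, (hev t ht).deriv.deriv_eq, (hev t ht).deriv_eq, (hev t ht).eq_of_nhds]
  have habs : ∀ t ∈ Set.Ioo (τ - δ) (τ + δ), |t - τ| < 3 * δ := fun t ht => by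
    rw [abs_lt]; constructor <;> linarith [ht.1, ht.2]
  have hsub : Set.uIcc x y ⊆ Set.Ioo (τ - δ) (τ + δ) := Set.ordConnected_Ioo.uIcc_subset hx hy
  obtain ⟨m, hm, a, ha, haδ, E, hE, hE0, hEper, hid, hu0, hint⟩ :=
    exists_secant_period_eq_two_pi hg hg0 (x := x) (y := y)
      (fun m hm => by
        rw [hgq m (habs m (hsub hm))]
        exact (hreg m (by linarith [habs m (hsub hm)])).2.2)
      (by rw [hgq x (habs x hx)]; exact hqx) (by rw [hgq y (habs y hy)]; exact hqy) hδ0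
  have hmI := hsub hm
  -- Since `|m - τ| < δ` and `a < δ`, the whole curve stays where `g = f`, so the secant of `g`
  -- serves for `f`.
  have hclose : ∀ t ∈ Set.Icc (m - a) (m + a), |t - τ| < 3 * δ := fun t ht => by
    rw [abs_lt]; constructor <;> linarith [ht.1, ht.2, hmI.1, hmI.2]
  have hgeq : ∀ t ∈ Set.Icc (m - a) (m + a), M.f t = g t := fun t ht =>
    (hev t (hclose t ht)).eq_of_nhds.symm
  have hX : ∀ φ, M.f (m + a * Real.cos φ) = g (m + a * Real.cos φ) := fun φ => hgeq _ <| by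
    constructor <;> nlinarith [Real.neg_one_le_cos φ, Real.cos_le_one φ]
  obtain ⟨γ, h1, h2, h3, h4⟩ := M.exists_unduloid_of_secant (h := secantSlope g m a) ha hE hE0
    hEper (fun t ht => by rw [hgeq t ht]; exact hasDerivAt_secant hg.continuous m a t)
    (fun φ => by rw [hX]; exact hid φ) hu0 (by simp only [hX]; exact hint)
  exact ⟨γ, h1, h2, h3, fun s => by linarith [hclose _ (h4 s)]⟩
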